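/- Let $H$ be a separable complex Hilbert space and let $A$ be a closed symmetric operator in $H$, whose domain is not assumed to be dense. Its adjoint is the linear relation $A^*=\{\{\eta,\omega\}\in H\oplus H:\langle\eta,A\varphi\rangle=\langle\omega,\varphi\rangle\text{ for all }\varphi\in\operatorname{dom}(A)\}$. Assume that $A$ has deficiency indices $(1,1)$, i.e. $\dim\ker(A^*- iI)=\dim\ker(A^*+iI)=1$; that $A$ is simple, i.e. $\bigcap_{z\in\mathbb C\setminus\mathbb R}\operatorname{ran}(A-zI)=\{0\}$; and that $A$ is regular, i.e. for every $z\in\mathbb C$ there is $d_z>0$ with $\|(A-zI)\psi\|\ge d_z\|\psi\|$ for all $\psi\in\operatorname{dom}(A)$. A selfadjoint extension of $A$ within $H$ is a linear relation $B\subseteq H\oplus H$ with $B=B^*$ that contains the graph of $A$ (it need not be the graph of an operator). The spectrum $\operatorname{Sp}(B)$ is the complement of the set of all $z\in\mathbb C$ for which $(B-zI)^{-1}$ is a bounded operator defined on all of $H$. Then: (i) For every selfadjoint extension $B$ of $A$ within $H$, $\operatorname{Sp}(B)$ is real and consists solely of isolated eigenvalues of multiplicity one. (ii) Every real number belongs to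 the spectrum of one, and only one, selfadjoint extension of $A$ within $H$. (iii) The spectra of any two distinct selfadjoint extensions of $A$ within $H$ are interlaced: they are disjoint, and between any two consecutive points of either of them there is exactly one point of the other. -/

import Mathlib

open scoped InnerProductSpace

namespace SymmetricOperator

variable {H : Type*} [NormedAddCommGroup H] [InnerProductSpace ℂ H]

/-- A linear relation in `H`: a linear subspace of `H × H`. An operator `A : H →ₗ.[ℂ] H` is
identified with the linear relation `A.graph`. The adjoint relation is `Submodule.adjoint`. -/
abbrev LinRel (H : Type*) [NormedAddCommGroup H] [InnerProductSpace ℂ H] : Type _ :=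
  Submodule ℂ (H × H)

namespace LinRel

/-- The relation `B - z I = {(x, y - z x) : (x, y) ∈ B}`. -/
def shift (B : LinRel H) (z : ℂ) : LinRel H :=
  B.map ((LinearMap.fst ℂ H H).prod (LinearMap.snd ℂ H H - z • LinearMap.fst ℂ H H))

/-- The inverse relation `B⁻¹ = {(y, x) : (x, y) ∈ B}`. -/
def inv (B : LinRel H) : LinRel H :=
  B.map (LinearEquiv.prodComm ℂ H H : H × H →ₗ[ℂ] H × H)

/-- The kernel `{x : (x, 0) ∈ B}`. -/
def ker (B : LinRel H) : Submodule ℂ H :=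
  B.comap (LinearMap.inl ℂ H H)

/-- The spectrum of `B`: the complement of the set of those `z : ℂ` for which `(B - z I)⁻¹` is
(the graph of) a bounded operator defined on all of `H`. -/
def spectrum (B : LinRel H) : Set ℂ :=
  {z : ℂ | ∃ R : H →L[ℂ] H, (B.shift z).inv = (R : H →ₗ[ℂ] H).graph}ᶜ

/-- The set of real points of the spectrum. -/
def realSpectrum (B : LinRel H) : Set ℝ :=
  {x : ℝ | (x : ℂ) ∈ B.spectrum}

/-- A linear relation is selfadjoint if it coincides with its adjoint relation. -/
def IsSelfAdjoint (B : LinRel H) : Prop :=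
  Submodule.adjoint B = B

end LinRel

/-- `B` is a selfadjoint extension, within `H`, of the operator `A`: a selfadjoint linear relation
in `H` that contains the graph of `A`. -/
def IsSelfAdjointExtension (A : H →ₗ.[ℂ] H) (B : LinRel H) : Prop :=
  A.graph ≤ B ∧ B.IsSelfAdjoint

/-- The defect space `ker (A* - z I) = ran (A - z̄ I)ᗮ`, where `A*` is the adjoint relation. -/
noncomputable def defectSpace (A : H →ₗ.[ℂ] H) (z : ℂ) : Submodule ℂ H :=
  LinRel.ker (LinRel.shift (Submodule.adjoint A.graph) z)

/-- The range of the operator `A - z I`, whose domain is that of `A`. -/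
def ranSub (A : H →ₗ.[ℂ] H) (z : ℂ) : Submodule ℂ H :=
  LinearMap.range (A.toFun - z • A.domain.subtype)

/-- The operator `A` is symmetric; its domain need not be dense. -/
def IsSymmetric (A : H →ₗ.[ℂ] H) : Prop :=
  ∀ x y : A.domain, ⟪A x, (y : H)⟫_ℂ = ⟪(x : H), A y⟫_ℂ

/-- `A` has deficiency indices `(1, 1)`. -/
def HasDeficiencyIndicesOneOne (A : H →ₗ.[ℂ] H) : Prop :=
  Module.finrank ℂ (defectSpace A Complex.I) = 1 ∧
    Module.finrank ℂ (defectSpace A (-Complex.I)) = 1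

/-- `A` is simple: the ranges of `A - z I`, for `z` non-real, have trivial intersection. -/
def IsSimple (A : H →ₗ.[ℂ] H) : Prop :=
  ⨅ z ∈ {z : ℂ | z.im ≠ 0}, ranSub A z = ⊥

/-- `A` is regular: every point of the complex plane is a point of regular type. -/
def IsRegular (A : H →ₗ.[ℂ] H) : Prop :=
  ∀ z : ℂ, ∃ d : ℝ, 0 < d ∧ ∀ x : A.domain, d * ‖(x : H)‖ ≤ ‖A x - z • (x : H)‖

/-- The class `𝔈₁(H)` of simple, regular, closed symmetric operators in `H`, not necessarily
densely defined, with deficiency indices `(1, 1)`. -/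
structure ClassEOne (A : H →ₗ.[ℂ] H) : Prop where
  symmetric : IsSymmetric A
  closed : A.IsClosed
  simple : IsSimple A
  regular : IsRegular A
  deficiency : HasDeficiencyIndicesOneOne A

/-- Between any two consecutive points of `S` there is exactly one point of `T`. -/
def Separates (T S : Set ℝ) : Prop :=
  ∀ a ∈ S, ∀ b ∈ S, a < b → (∀ c ∈ S, ¬ (a < c ∧ c < b)) → ∃! t, t ∈ T ∧ a < t ∧ t < b

/-- Two sets of real numbers are interlaced if they are disjoint and between any two consecutive
points of either of them there is exactly one point of the other. -/
def Interlaced (S T : Set ℝ) : Prop :=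
  Disjoint S T ∧ Separates T S ∧ Separates S T

end SymmetricOperator

namespace SymmetricOperator

variable {H : Type*} [NormedAddCommGroup H] [InnerProductSpace ℂ H]

/-! Regularity makes the defect dimension locally constant on the connected plane, hence 1
everywhere (`finrank_defect_eq`). So `ran (G - z)` is always a closed hyperplane φᗮ, with φ spanning
the defect space at z̄ (`exists_sub_eq`). Spectral points of an extension are therefore eigenvalues
with eigenvectors in a line, and one real eigenvalue determines the extension as `G` plus that
eigenvector. This gives (i), (ii) and disjointness.

For interlacing (`exists_mem_Icc`), let a < b be eigenvalues of `B` and suppose that `C` has no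
spectrum in [a, b]. With T = (C - a)⁻¹, all 1 - sT for 0 ≤ s ≤ b - a are invertible, so S = 1 - (b -
a)T is positive. If φ is the a-eigenvector of `B`, then S⁻¹φ lies in the defect space at b, hence is
a multiple of the b-eigenvector, which is orthogonal to φ. Thus ⟨S⁻¹φ, φ⟩ = 0, and positivity of S
forces φ = 0. -/

/-- A spectral value r < 0 of 1 - cT would make 1 - sT singular at s = c/(1 - r), which lies in [0,
c]. -/
theorem one_sub_smul_nonneg {A : Type*} [CStarAlgebra A] [PartialOrder A] [StarOrderedRing A]
    {T : A} (hT : IsSelfAdjoint T) {c : ℝ} (hc : 0 ≤ c)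
    (h : ∀ s ∈ Set.Icc 0 c, IsUnit (1 - s • T)) : 0 ≤ 1 - c • T := by
  rw [StarOrderedRing.nonneg_iff_spectrum_nonneg (R := ℝ) _
    ((IsSelfAdjoint.one _).sub ((IsSelfAdjoint.all c).smul hT))]
  intro r hr
  by_contra! hr0
  refine hr ?_
  have h1r : 0 < 1 - r := by linarith
  have hs : c / (1 - r) ∈ Set.Icc 0 c := ⟨div_nonneg hc h1r.le, div_le_self hc (by linarith)⟩
  have hne : -(1 - r) ≠ 0 := by linarith
  have e : algebraMap ℝ A r - (1 - c • T) = Units.mk0 (-(1 - r)) hne • (1 - (c / (1 - r)) • T) := by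
    rw [Algebra.algebraMap_eq_smul_one, Units.smul_mk0, smul_sub, smul_smul, neg_mul,
      mul_div_cancel₀ _ h1r.ne']
    module
  rw [spectrum.mem_resolventSet_iff, e]
  exact (h _ hs).smul _

/-! ### Linear relations, adjoints and resolvents -/

namespace LinRel

theorem mem_ker_shift {B : LinRel H} {z : ℂ} {x : H} :
    x ∈ (B.shift z).ker ↔ (x, z • x) ∈ B := by
  simp only [ker, shift, Submodule.mem_comap, Submodule.mem_map, Prod.exists]
  constructor
  · rintro ⟨a, b, h, e⟩
    obtain ⟨h1, h2⟩ := Prod.mk.inj e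
    replace h1 : a = x := h1
    replace h2 : b - z • a = 0 := h2
    rw [sub_eq_zero] at h2
    rwa [← h1, ← h2]
  · intro h
    exact ⟨x, z • x, h, by simp⟩

theorem mem_inv_shift {B : LinRel H} {z : ℂ} {u w : H} :
    (w, u) ∈ (B.shift z).inv ↔ (u, w + z • u) ∈ B := by
  simp only [inv, shift, Submodule.mem_map, Prod.exists]
  constructor
  · rintro ⟨a, b, ⟨c, d, h, e⟩, e'⟩
    simp at e e'
    obtain ⟨rfl, rfl⟩ := e
    obtain ⟨rfl, rfl⟩ := e'
    simpa using h
  · intro h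
    exact ⟨u, w, ⟨u, w + z • u, h, by simp⟩, by simp⟩

theorem mem_adjoint_iff_inner {B : LinRel H} {p : H × H} :
    p ∈ Submodule.adjoint B ↔ ∀ q ∈ B, ⟪q.2, p.1⟫_ℂ = ⟪q.1, p.2⟫_ℂ := by
  simp [sub_eq_zero]

theorem adjoint_anti {B C : LinRel H} (h : B ≤ C) :
    Submodule.adjoint C ≤ Submodule.adjoint B := fun p hp ↦ by
  rw [mem_adjoint_iff_inner] at hp ⊢
  exact fun q hq ↦ hp q (h hq)

theorem isClosed_adjoint (B : LinRel H) : IsClosed (Submodule.adjoint B : Set (H × H)) := by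
  have : (Submodule.adjoint B : Set (H × H)) =
      ⋂ q ∈ B, {p : H × H | ⟪q.2, p.1⟫_ℂ = ⟪q.1, p.2⟫_ℂ} := by
    ext p
    rw [SetLike.mem_coe, mem_adjoint_iff_inner]
    simp
  rw [this]
  exact isClosed_biInter fun q _ ↦ isClosed_eq (by fun_prop) (by fun_prop)

theorem IsSelfAdjoint.isClosed {B : LinRel H} (hB : B.IsSelfAdjoint) :
    IsClosed (B : Set (H × H)) := hB ▸ isClosed_adjoint B

theorem IsSelfAdjoint.inner_eq {B : LinRel H} (hB : B.IsSelfAdjoint) {p q : H × H}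
    (hp : p ∈ B) (hq : q ∈ B) : ⟪q.2, p.1⟫_ℂ = ⟪q.1, p.2⟫_ℂ :=
  mem_adjoint_iff_inner.1 (hB.symm ▸ hp) q hq

/-- The map `(u, v) ↦ v - z u` on the linear relation `B`. -/
def subMap (B : LinRel H) (z : ℂ) : B →L[ℂ] H :=
  (ContinuousLinearMap.snd ℂ H H - z • ContinuousLinearMap.fst ℂ H H).comp B.subtypeL

theorem subMap_apply (B : LinRel H) (z : ℂ) (p : B) :
    B.subMap z p = (p : H × H).2 - z • (p : H × H).1 := rfl

/-- Boundedness of the inverse is automatic: a closed relation is a Banach space, and the open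
mapping theorem applies to `subMap`. -/
theorem notMem_spectrum_iff [CompleteSpace H] {B : LinRel H} (hB : IsClosed (B : Set (H × H)))
    {z : ℂ} : z ∉ B.spectrum ↔ ∀ w, ∃! u, (u, w + z • u) ∈ B := by
  rw [spectrum, Set.notMem_compl_iff, Set.mem_ofPred_eq]
  constructor
  · rintro ⟨R, hR⟩ w
    have key (u : H) : (u, w + z • u) ∈ B ↔ u = R w := by
      rw [← mem_inv_shift, hR, LinearMap.mem_graph_iff]
      rfl
    exact ⟨R w, (key _).2 rfl, fun u hu ↦ (key u).1 hu⟩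
  · intro h
    have := hB.completeSpace_coe
    have hinj : (B.subMap z).ker = ⊥ := by
      rw [LinearMap.ker_eq_bot']
      rintro ⟨⟨u, v⟩, hp⟩ e
      have e' : v = z • u := sub_eq_zero.1 e
      subst e'
      have hu : u = 0 := (h 0).unique (by simpa using hp) (by simp [← Prod.zero_eq_mk])
      simp [hu]
    have hsurj : (B.subMap z).range = ⊤ := by
      rw [LinearMap.range_eq_top]
      intro w
      obtain ⟨u, hu, -⟩ := h w
      exact ⟨⟨_, hu⟩, by
        change B.subMap z _ = w
        simp [subMap_apply]⟩
    let e := ContinuousLinearEquiv.ofBijective (B.subMap z) hinj hsurj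
    refine ⟨(ContinuousLinearMap.fst ℂ H H).comp
      (B.subtypeL.comp (e.symm : H →L[ℂ] B)), ?_⟩
    have hmem (w : H) : (((e.symm w : B) : H × H).1, w + z • ((e.symm w : B) : H × H).1) ∈ B := by
      have h1 : B.subMap z (e.symm w) = w := e.apply_symm_apply w
      rw [subMap_apply, sub_eq_iff_eq_add] at h1
      conv in (w + _) => rw [← h1]
      exact (e.symm w).2
    ext ⟨w, u⟩
    rw [mem_inv_shift, LinearMap.mem_graph_iff]
    constructor
    · intro hu
      exact (h w).unique hu (hmem w)
    · intro hu
      have : u = ((e.symm w : B) : H × H).1 := hu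
      rw [this]
      exact hmem w

/-! ### Defect spaces and points of regular type -/

/-- The defect space `ker (B* - z I)`. -/
noncomputable def defect (B : LinRel H) (z : ℂ) : Submodule ℂ H :=
  ker (shift (Submodule.adjoint B) z)

theorem mem_defect {B : LinRel H} {z : ℂ} {x : H} :
    x ∈ B.defect z ↔ (x, z • x) ∈ Submodule.adjoint B := mem_ker_shift

theorem mem_defect_iff_inner {B : LinRel H} {z : ℂ} {x : H} :
    x ∈ B.defect z ↔ ∀ p ∈ B, ⟪p.2 - (starRingEnd ℂ z) • p.1, x⟫_ℂ = 0 := by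
  rw [mem_defect, mem_adjoint_iff_inner]
  refine forall₂_congr fun p _ ↦ ?_
  rw [inner_sub_left, inner_smul_left, inner_smul_right, Complex.conj_conj, sub_eq_zero]

theorem defect_eq_orthogonal (B : LinRel H) (z : ℂ) :
    B.defect z = (B.subMap (starRingEnd ℂ z)).rangeᗮ := by
  ext x
  rw [mem_defect_iff_inner, Submodule.mem_orthogonal]
  constructor
  · rintro h _ ⟨p, rfl⟩
    exact h p p.2
  · intro h p hp
    exact h _ ⟨⟨p, hp⟩, rfl⟩

/-- `B - z I` is bounded below by `d`. -/
def BoundedBelow (B : LinRel H) (z : ℂ) (d : ℝ) : Prop :=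
  ∀ p ∈ B, d * ‖p.1‖ ≤ ‖p.2 - z • p.1‖

theorem BoundedBelow.isClosed_range [CompleteSpace H] {B : LinRel H}
    (hB : IsClosed (B : Set (H × H))) {z : ℂ} {d : ℝ} (hd : 0 < d) (h : B.BoundedBelow z d) :
    IsClosed ((B.subMap z).range : Set H) := by
  have := hB.completeSpace_coe
  have hK : 0 ≤ 1 + (1 + ‖z‖) / d := by positivity
  have : AntilipschitzWith ⟨1 + (1 + ‖z‖) / d, hK⟩ (B.subMap z) := by
    refine AddMonoidHomClass.antilipschitz_of_bound (B.subMap z) fun p ↦ ?_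
    have h1 : ‖(p : H × H).1‖ ≤ ‖B.subMap z p‖ / d := by
      rw [le_div_iff₀ hd, mul_comm]
      exact h p p.2
    have h2 : ‖(p : H × H).2‖ ≤ ‖B.subMap z p‖ + ‖z‖ * ‖(p : H × H).1‖ := by
      rw [← norm_smul, subMap_apply]
      exact norm_le_norm_sub_add _ _
    have h3 : ‖z‖ * ‖(p : H × H).1‖ ≤ ‖z‖ * (‖B.subMap z p‖ / d) := by gcongr
    have e : (1 + (1 + ‖z‖) / d) * ‖B.subMap z p‖ =
        ‖B.subMap z p‖ + ‖B.subMap z p‖ / d + ‖z‖ * (‖B.subMap z p‖ / d) := by ring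
    change ‖(p : H × H)‖ ≤ (1 + (1 + ‖z‖) / d) * ‖B.subMap z p‖
    rw [e, Prod.norm_def]
    have h4 : 0 ≤ ‖B.subMap z p‖ / d := by positivity
    have h5 : 0 ≤ ‖z‖ * (‖B.subMap z p‖ / d) := by positivity
    have h6 := norm_nonneg (B.subMap z p)
    exact max_le (by linarith) (by linarith)
  exact this.isClosed_range (B.subMap z).uniformContinuous

/-- A vector of `ran (B - w I)` that is orthogonal to `ran (B - z I)` vanishes if `z` is
close to `w`. -/
theorem BoundedBelow.eq_zero {B : LinRel H} {z w : ℂ} {d : ℝ}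
    (h : B.BoundedBelow w d) (hzw : ‖w - z‖ < d) {p : H × H} (hp : p ∈ B)
    (h0 : ⟪p.2 - z • p.1, p.2 - w • p.1⟫_ℂ = 0) : p.2 - w • p.1 = 0 := by
  have hd : 0 < d := (norm_nonneg _).trans_lt hzw
  by_contra hv
  have hv' : 0 < ‖p.2 - w • p.1‖ := norm_pos_iff.2 hv
  set v := p.2 - w • p.1 with hvdef
  -- Orthogonality yields ‖v‖ ≤ ‖w - z‖ ‖p.1‖, against d ‖p.1‖ ≤ ‖v‖.
  have e : p.2 - z • p.1 = v + (w - z) • p.1 := by rw [hvdef]; module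
  rw [e, inner_add_left, add_eq_zero_iff_eq_neg, inner_self_eq_norm_sq_to_K] at h0
  have h1 : ‖v‖ ^ 2 ≤ ‖w - z‖ * ‖p.1‖ * ‖v‖ := by
    have := congrArg norm h0
    rw [norm_neg, norm_pow, RCLike.norm_ofReal, abs_norm] at this
    rw [this, ← norm_smul]
    exact norm_inner_le_norm _ _
  have h2 : d * ‖p.1‖ ≤ ‖v‖ := h p hp
  have h3 : ‖v‖ ≤ ‖w - z‖ * ‖p.1‖ := by
    rw [sq] at h1
    exact le_of_mul_le_mul_right h1 hv'
  rcases eq_or_lt_of_le (norm_nonneg p.1) with h4 | h4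
  · rw [← h4, mul_zero] at h3
    linarith
  · nlinarith

theorem BoundedBelow.of_norm_sub_le {B : LinRel H} {z w : ℂ} {d : ℝ} (h : B.BoundedBelow w d) :
    B.BoundedBelow z (d - ‖w - z‖) := fun p hp ↦ by
  have e : p.2 - w • p.1 = (p.2 - z • p.1) - (w - z) • p.1 := by module
  have h1 := h p hp
  have h2 := norm_sub_le (p.2 - z • p.1) ((w - z) • p.1)
  rw [← e, norm_smul] at h2
  linarith

/-- The orthogonal projection of one defect space to the other is injective: a vector it kills lies
in the closed range of `B - w̄` and is orthogonal to that of `B - z̄`, so `eq_zero` applies. -/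
theorem BoundedBelow.rank_defect_le [CompleteSpace H] {B : LinRel H}
    (hB : IsClosed (B : Set (H × H))) {z w : ℂ} {d : ℝ}
    (h : B.BoundedBelow (starRingEnd ℂ w) d) (hzw : ‖w - z‖ < d) :
    Module.rank ℂ (B.defect z) ≤ Module.rank ℂ (B.defect w) := by
  have hd : 0 < d := (norm_nonneg _).trans_lt hzw
  have hcl := h.isClosed_range hB hd
  have : CompleteSpace (B.subMap (starRingEnd ℂ w)).range := hcl.completeSpace_coe
  rw [defect_eq_orthogonal B w]
  let f : B.defect z →ₗ[ℂ] (B.subMap (starRingEnd ℂ w)).rangeᗮ :=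
    ((B.subMap (starRingEnd ℂ w)).rangeᗮ.orthogonalProjectionOnto : _ →ₗ[ℂ] _).comp
      (B.defect z).subtype
  refine LinearMap.rank_le_of_injective f ((injective_iff_map_eq_zero f).2 fun x hx ↦ ?_)
  have hx' : (x : H) ∈ (B.subMap (starRingEnd ℂ w)).range := by
    have : (x : H) ∈ (B.subMap (starRingEnd ℂ w)).rangeᗮᗮ :=
      Submodule.orthogonalProjectionOnto_eq_zero_iff.1 hx
    rwa [Submodule.orthogonal_orthogonal] at this
  obtain ⟨p, hp⟩ := hx'
  have hp' : (p : H × H).2 - (starRingEnd ℂ w) • (p : H × H).1 = x := hp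
  have := h.eq_zero (z := starRingEnd ℂ z)
    (by rwa [← map_sub, RCLike.norm_conj]) p.2
    (by rw [hp']; exact mem_defect_iff_inner.1 x.2 p p.2)
  exact Subtype.ext (hp'.symm.trans this)

/-- If every point is of regular type, the dimension of the defect spaces is constant. -/
theorem finrank_defect_eq [CompleteSpace H] {B : LinRel H} (hB : IsClosed (B : Set (H × H)))
    (hreg : ∀ z, ∃ d : ℝ, 0 < d ∧ B.BoundedBelow z d) (z w : ℂ) :
    Module.finrank ℂ (B.defect z) = Module.finrank ℂ (B.defect w) := by
  have hloc : IsLocallyConstant fun z ↦ Module.finrank ℂ (B.defect z) := by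
    rw [IsLocallyConstant.iff_eventually_eq]
    intro w
    obtain ⟨d, hd, h⟩ := hreg (starRingEnd ℂ w)
    -- Radius d/2 keeps the bound d - ‖w - z‖ at z̄ above ‖w - z‖, so the rank inequality holds both
    -- ways.
    filter_upwards [Metric.ball_mem_nhds w (half_pos hd)] with z hz
    rw [Metric.mem_ball, dist_eq_norm] at hz
    have hz' : ‖w - z‖ < d / 2 := by rwa [norm_sub_rev]
    have h' := h.of_norm_sub_le (z := starRingEnd ℂ z)
    rw [← map_sub, RCLike.norm_conj] at h'
    exact congrArg Cardinal.toNat (le_antisymm (h.rank_defect_le hB (by linarith))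
      (h'.rank_defect_le hB (by linarith)))
  exact hloc.apply_eq_of_isPreconnected isPreconnected_univ (Set.mem_univ z) (Set.mem_univ w)

/-! ### Spectra of selfadjoint extensions in defect one -/

/-- A closed linear relation of which every point is a point of regular type, and whose defect
spaces are one-dimensional. -/
structure IsRegularDefectOne (G : LinRel H) : Prop where
  isClosed : IsClosed (G : Set (H × H))
  boundedBelow : ∀ z, ∃ d : ℝ, 0 < d ∧ G.BoundedBelow z d
  finrank_defect : ∀ z, Module.finrank ℂ (G.defect z) = 1

variable {G B C : LinRel H}

theorem IsRegularDefectOne.exists_ne_zero (hG : G.IsRegularDefectOne) (z : ℂ) :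
    ∃ φ ∈ G.defect z, φ ≠ 0 := by
  obtain ⟨v, hv, -⟩ := finrank_eq_one_iff'.1 (hG.finrank_defect z)
  exact ⟨v, v.2, by simpa using hv⟩

theorem IsRegularDefectOne.eq_smul (hG : G.IsRegularDefectOne) {z : ℂ} {φ x : H}
    (hφ : φ ∈ G.defect z) (hφ0 : φ ≠ 0) (hx : x ∈ G.defect z) : ∃ c : ℂ, c • φ = x := by
  have hne : (⟨φ, hφ⟩ : G.defect z) ≠ 0 := by simpa using hφ0
  obtain ⟨c, hc⟩ := (finrank_eq_one_iff_of_nonzero' _ hne).1 (hG.finrank_defect z) ⟨x, hx⟩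
  exact ⟨c, congrArg Subtype.val hc⟩

theorem IsRegularDefectOne.exists_sub_eq [CompleteSpace H] (hG : G.IsRegularDefectOne) {z : ℂ}
    {φ y : H} (hφ : φ ∈ G.defect (starRingEnd ℂ z)) (hφ0 : φ ≠ 0) (hy : ⟪φ, y⟫_ℂ = 0) :
    ∃ p ∈ G, p.2 - z • p.1 = y := by
  obtain ⟨d, hd, h⟩ := hG.boundedBelow z
  have : CompleteSpace (G.subMap z).range := (h.isClosed_range hG.isClosed hd).completeSpace_coe
  have hy' : y ∈ (G.subMap z).rangeᗮᗮ := by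
    have e := defect_eq_orthogonal G (starRingEnd ℂ z)
    rw [Complex.conj_conj] at e
    rw [← e, Submodule.mem_orthogonal]
    intro x hx
    obtain ⟨c, rfl⟩ := hG.eq_smul hφ hφ0 hx
    rw [inner_smul_left, hy, mul_zero]
  rw [Submodule.orthogonal_orthogonal] at hy'
  obtain ⟨p, hp⟩ := hy'
  exact ⟨p, p.2, hp⟩

theorem IsSelfAdjoint.le_adjoint (hB : B.IsSelfAdjoint) (hGB : G ≤ B) :
    B ≤ Submodule.adjoint G :=
  hB.symm.le.trans (adjoint_anti hGB)

theorem IsSelfAdjoint.conj_eq (hB : B.IsSelfAdjoint) {z : ℂ} {φ : H} (hφ : (φ, z • φ) ∈ B)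
    (hφ0 : φ ≠ 0) : starRingEnd ℂ z = z := by
  have h : ⟪z • φ, φ⟫_ℂ = ⟪φ, z • φ⟫_ℂ := hB.inner_eq hφ hφ
  rw [inner_smul_left, inner_smul_right] at h
  exact mul_right_cancel₀ (inner_self_ne_zero.2 hφ0) h

theorem mem_spectrum_of_eigenvector [CompleteSpace H] (hB : IsClosed (B : Set (H × H))) {z : ℂ}
    {φ : H} (hφ : (φ, z • φ) ∈ B) (hφ0 : φ ≠ 0) : z ∈ B.spectrum := by
  by_contra h
  exact hφ0 (((notMem_spectrum_iff hB).1 h 0).unique (by simpa using hφ)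
    (by simp [← Prod.zero_eq_mk]))

theorem IsRegularDefectOne.exists_eigenvector [CompleteSpace H] (hG : G.IsRegularDefectOne)
    (hGB : G ≤ B) (hB : B.IsSelfAdjoint) {z : ℂ} (hz : z ∈ B.spectrum) :
    ∃ φ : H, φ ≠ 0 ∧ (φ, z • φ) ∈ B := by
  by_contra! hno
  refine (notMem_spectrum_iff hB.isClosed).2 (fun w ↦ ?_) hz
  obtain ⟨φ, hφ, hφ0⟩ := hG.exists_ne_zero (starRingEnd ℂ z)
  -- Otherwise z is real and φ is an eigenvector. Hence `ran (B - z)` exceeds the hyperplane φᗮ, and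
  -- `B - z` is onto.
  have hφB : φ ∉ B.defect (starRingEnd ℂ z) := by
    rw [mem_defect, hB]
    intro h
    have e := hB.conj_eq h hφ0
    rw [Complex.conj_conj] at e
    rw [← e] at h
    exact hno φ hφ0 h
  rw [mem_defect_iff_inner] at hφB
  push Not at hφB
  obtain ⟨q, hq, hqφ⟩ := hφB
  rw [Complex.conj_conj] at hqφ
  have hφq : ⟪φ, q.2 - z • q.1⟫_ℂ ≠ 0 := by
    rwa [Ne, inner_eq_zero_symm]
  obtain ⟨p, hp, e⟩ := hG.exists_sub_eq (y := w - (⟪φ, w⟫_ℂ / ⟪φ, q.2 - z • q.1⟫_ℂ) •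
    (q.2 - z • q.1)) hφ hφ0 (by
      rw [inner_sub_right, inner_smul_right, div_mul_cancel₀ _ hφq, sub_self])
  set c := ⟪φ, w⟫_ℂ / ⟪φ, q.2 - z • q.1⟫_ℂ
  have hw : w = p.2 - z • p.1 + c • (q.2 - z • q.1) := by rw [e]; abel
  refine ⟨p.1 + c • q.1, ?_, fun u hu ↦ ?_⟩
  · have e' : (p.1 + c • q.1, w + z • (p.1 + c • q.1)) = p + c • q := by
      ext
      · rfl
      · change w + z • (p.1 + c • q.1) = p.2 + c • q.2
        rw [hw]
        module
    change (_, _) ∈ B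
    rw [e']
    exact B.add_mem (hGB hp) (B.smul_mem c hq)
  · have e' : (u, w + z • u) - (p + c • q) = (u - (p.1 + c • q.1), z • (u - (p.1 + c • q.1))) := by
      ext
      · rfl
      · change w + z • u - (p.2 + c • q.2) = z • (u - (p.1 + c • q.1))
        rw [hw]
        module
    have h := B.sub_mem hu (B.add_mem (hGB hp) (B.smul_mem c hq))
    rw [e'] at h
    by_contra hne
    exact hno _ (sub_ne_zero.2 hne) h

theorem IsRegularDefectOne.im_eq_zero [CompleteSpace H] (hG : G.IsRegularDefectOne)
    (hGB : G ≤ B) (hB : B.IsSelfAdjoint) {z : ℂ} (hz : z ∈ B.spectrum) : z.im = 0 := by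
  obtain ⟨φ, hφ0, hφ⟩ := hG.exists_eigenvector hGB hB hz
  exact Complex.conj_eq_iff_im.1 (hB.conj_eq hφ hφ0)

theorem IsRegularDefectOne.finrank_ker [CompleteSpace H] (hG : G.IsRegularDefectOne)
    (hGB : G ≤ B) (hB : B.IsSelfAdjoint) {z : ℂ} (hz : z ∈ B.spectrum) :
    Module.finrank ℂ (B.shift z).ker = 1 := by
  obtain ⟨φ, hφ0, hφ⟩ := hG.exists_eigenvector hGB hB hz
  have hle : ∀ {x : H}, (x, z • x) ∈ B → x ∈ G.defect z := fun hx ↦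
    mem_defect.2 (hB.le_adjoint hGB hx)
  refine finrank_eq_one_iff'.2 ⟨⟨φ, mem_ker_shift.2 hφ⟩, by simpa using hφ0, fun x ↦ ?_⟩
  obtain ⟨c, hc⟩ := hG.eq_smul (hle hφ) hφ0 (hle (mem_ker_shift.1 x.2))
  exact ⟨c, Subtype.ext hc⟩

theorem IsSelfAdjoint.inner_eigenvectors_eq_zero (hB : B.IsSelfAdjoint) {z w : ℂ} {φ ψ : H}
    (hφ : (φ, z • φ) ∈ B) (hψ : (ψ, w • ψ) ∈ B) (hφ0 : φ ≠ 0) (hzw : z ≠ w) :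
    ⟪φ, ψ⟫_ℂ = 0 := by
  have h : ⟪z • φ, ψ⟫_ℂ = ⟪φ, w • ψ⟫_ℂ := hB.inner_eq hψ hφ
  rw [inner_smul_left, inner_smul_right, hB.conj_eq hφ hφ0] at h
  have : (z - w) * ⟪φ, ψ⟫_ℂ = 0 := by rw [sub_mul, h, sub_self]
  exact (mul_eq_zero.1 this).resolve_left (sub_ne_zero.2 hzw)

/-- The regularity constant d at z is a radius of isolation: an eigenvector ψ at a nearby w ≠ z is
orthogonal to φ, so lies in `ran (G - z)`, yet is orthogonal to `ran (G - w)`; by `eq_zero` it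
vanishes. -/
theorem IsRegularDefectOne.isolated [CompleteSpace H] (hG : G.IsRegularDefectOne)
    (hGB : G ≤ B) (hB : B.IsSelfAdjoint) {z : ℂ} (hz : z ∈ B.spectrum) :
    ∃ ε > 0, B.spectrum ∩ Metric.ball z ε = {z} := by
  obtain ⟨d, hd, hbd⟩ := hG.boundedBelow z
  refine ⟨d, hd, Set.eq_singleton_iff_unique_mem.2 ⟨⟨hz, Metric.mem_ball_self hd⟩, ?_⟩⟩
  rintro w ⟨hw, hwz⟩
  by_contra hne
  rw [Metric.mem_ball, dist_comm, dist_eq_norm] at hwz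
  obtain ⟨φ, hφ0, hφ⟩ := hG.exists_eigenvector hGB hB hz
  obtain ⟨ψ, hψ0, hψ⟩ := hG.exists_eigenvector hGB hB hw
  have hφd : φ ∈ G.defect (starRingEnd ℂ z) := by
    rw [hB.conj_eq hφ hφ0]
    exact mem_defect.2 (hB.le_adjoint hGB hφ)
  obtain ⟨p, hp, e⟩ := hG.exists_sub_eq hφd hφ0
    (hB.inner_eigenvectors_eq_zero hφ hψ hφ0 (Ne.symm hne))
  have hψd := mem_defect_iff_inner.1 (mem_defect.2 (hB.le_adjoint hGB hψ)) p hp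
  rw [hB.conj_eq hψ hψ0, ← e] at hψd
  exact hψ0 (e ▸ hbd.eq_zero hwz hp hψd)

/-! ### Extensions with a prescribed eigenvalue -/

/-- The extension of `G` by the eigenvector `φ` with eigenvalue `x`. -/
def extend (G : LinRel H) (x : ℂ) (φ : H) : LinRel H :=
  G ⊔ Submodule.span ℂ {(φ, x • φ)}

theorem le_extend (G : LinRel H) (x : ℂ) (φ : H) : G ≤ G.extend x φ := le_sup_left

theorem mem_extend_self (G : LinRel H) (x : ℂ) (φ : H) : (φ, x • φ) ∈ G.extend x φ :=
  Submodule.mem_sup_right (Submodule.mem_span_singleton_self _)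

theorem IsRegularDefectOne.isSelfAdjoint_extend [CompleteSpace H] (hG : G.IsRegularDefectOne)
    (hsymm : G ≤ Submodule.adjoint G) {x : ℂ} (hx : starRingEnd ℂ x = x) {φ : H}
    (hφ : φ ∈ G.defect x) (hφ0 : φ ≠ 0) : (G.extend x φ).IsSelfAdjoint := by
  refine le_antisymm ?_ ?_
  · intro p hp
    have hpG : p ∈ Submodule.adjoint G := adjoint_anti (G.le_extend x φ) hp
    have h : ⟪x • φ, p.1⟫_ℂ = ⟪φ, p.2⟫_ℂ :=
      mem_adjoint_iff_inner.1 hp _ (G.mem_extend_self x φ)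
    have h0 : ⟪φ, p.2 - x • p.1⟫_ℂ = 0 := by
      rw [inner_sub_right, ← h, inner_smul_left, inner_smul_right, hx, sub_self]
    -- Subtracting q from p leaves a pair (u, x u) with u in the defect line spanned by φ.
    obtain ⟨q, hq, e⟩ := hG.exists_sub_eq (z := x) (by rwa [hx]) hφ0 h0
    have hpq : (p.1 - q.1, x • (p.1 - q.1)) = p - q := by
      ext
      · rfl
      · change x • (p.1 - q.1) = p.2 - q.2
        have : p.2 - q.2 = (p.2 - x • p.1) - (q.2 - x • q.1) + x • (p.1 - q.1) := by module
        rw [this, e, sub_self, zero_add]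
    have hd : p.1 - q.1 ∈ G.defect x := by
      rw [mem_defect, hpq]
      exact Submodule.sub_mem _ hpG (hsymm hq)
    obtain ⟨c, hc⟩ := hG.eq_smul hφ hφ0 hd
    have : p = q + c • (φ, x • φ) := by
      rw [← sub_eq_iff_eq_add', ← hpq, ← hc]
      ext
      · rfl
      · exact smul_comm _ _ _
    rw [this]
    exact Submodule.add_mem _ (G.le_extend x φ hq) (Submodule.smul_mem _ c (G.mem_extend_self x φ))
  · refine sup_le (fun p hp ↦ ?_) ((Submodule.span_singleton_le_iff_mem _ _).2 ?_) <;>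
      rw [mem_adjoint_iff_inner] <;> intro q hq <;>
      obtain ⟨r, hr, s, hs, rfl⟩ := Submodule.mem_sup.1 hq <;>
      obtain ⟨c, rfl⟩ := Submodule.mem_span_singleton.1 hs
    · have h1 := mem_adjoint_iff_inner.1 (hsymm hp) r hr
      have h2 := mem_adjoint_iff_inner.1 (mem_defect.1 hφ) p hp
      have h3 : ⟪x • φ, p.1⟫_ℂ = ⟪φ, p.2⟫_ℂ := by
        rw [← inner_conj_symm, ← inner_conj_symm φ]
        exact congrArg _ h2.symm
      change ⟪r.2 + c • x • φ, p.1⟫_ℂ = ⟪r.1 + c • φ, p.2⟫_ℂ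
      rw [inner_add_left, inner_add_left, h1, inner_smul_left _ _ c, inner_smul_left _ _ c, h3]
    · have h1 := mem_adjoint_iff_inner.1 (mem_defect.1 hφ) r hr
      change ⟪r.2 + c • x • φ, φ⟫_ℂ = ⟪r.1 + c • φ, x • φ⟫_ℂ
      rw [inner_add_left, inner_add_left, h1, inner_smul_left _ _ c, inner_smul_left _ _ c,
        inner_smul_left, inner_smul_right _ _ x, inner_smul_right _ _ x, hx]

theorem IsRegularDefectOne.eq_of_mem_spectrum [CompleteSpace H] (hG : G.IsRegularDefectOne)
    (hGB : G ≤ B) (hB : B.IsSelfAdjoint) (hGC : G ≤ C) (hC : C.IsSelfAdjoint)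
    (hsymm : G ≤ Submodule.adjoint G) {x : ℂ} (hxB : x ∈ B.spectrum) (hxC : x ∈ C.spectrum) :
    B = C := by
  obtain ⟨φ, hφ, hφ0⟩ := hG.exists_ne_zero x
  have key {D : LinRel H} (hGD : G ≤ D) (hD : D.IsSelfAdjoint) (hxD : x ∈ D.spectrum) :
      D = G.extend x φ := by
    obtain ⟨ψ, hψ0, hψ⟩ := hG.exists_eigenvector hGD hD hxD
    have hx := hD.conj_eq hψ hψ0
    obtain ⟨c, rfl⟩ := hG.eq_smul (mem_defect.2 (hD.le_adjoint hGD hψ)) hψ0 hφ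
    have hE := hG.isSelfAdjoint_extend hsymm hx hφ hφ0
    have hle : G.extend x (c • ψ) ≤ D := by
      refine sup_le hGD ((Submodule.span_singleton_le_iff_mem _ _).2 ?_)
      have := D.smul_mem c hψ
      rwa [Prod.smul_mk, smul_comm] at this
    -- Taking adjoints reverses an inclusion, so nested selfadjoint relations coincide.
    refine le_antisymm ?_ hle
    have := adjoint_anti hle
    rwa [hD, hE] at this
  rw [key hGB hB hxB, key hGC hC hxC]

theorem IsRegularDefectOne.existsUnique_extension [CompleteSpace H] (hG : G.IsRegularDefectOne)
    (hsymm : G ≤ Submodule.adjoint G) {x : ℂ} (hx : starRingEnd ℂ x = x) :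
    ∃! B : LinRel H, (G ≤ B ∧ B.IsSelfAdjoint) ∧ x ∈ B.spectrum := by
  obtain ⟨φ, hφ, hφ0⟩ := hG.exists_ne_zero x
  have hE := hG.isSelfAdjoint_extend hsymm hx hφ hφ0
  have hxE := mem_spectrum_of_eigenvector hE.isClosed (G.mem_extend_self x φ) hφ0
  exact ⟨_, ⟨⟨G.le_extend x φ, hE⟩, hxE⟩, fun C hC ↦
    hG.eq_of_mem_spectrum hC.1.1 hC.1.2 (G.le_extend x φ) hE hsymm hC.2 hxE⟩

/-! ### Interlacing -/

/-- Between two points of the spectrum of a selfadjoint extension there is a point of the spectrum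
of any other one. -/
theorem IsRegularDefectOne.exists_mem_Icc [CompleteSpace H] (hG : G.IsRegularDefectOne)
    (hGB : G ≤ B) (hB : B.IsSelfAdjoint) (hGC : G ≤ C) (hC : C.IsSelfAdjoint)
    {a b : ℝ} (hab : a < b) (ha : (a : ℂ) ∈ B.spectrum) (hb : (b : ℂ) ∈ B.spectrum) :
    ∃ t ∈ Set.Icc a b, (t : ℂ) ∈ C.spectrum := by
  by_contra! hno
  obtain ⟨φ, hφ0, hφ⟩ := hG.exists_eigenvector hGB hB ha
  obtain ⟨χ, hχ0, hχ⟩ := hG.exists_eigenvector hGB hB hb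
  have haC := hno a ⟨le_rfl, hab.le⟩
  obtain ⟨T, hT⟩ := Set.notMem_compl_iff.1 haC
  have hTmem (u v : H) : (u, v + (a : ℂ) • u) ∈ C ↔ u = T v := by
    rw [← mem_inv_shift, hT, LinearMap.mem_graph_iff]
    rfl
  have hTsymm : _root_.IsSelfAdjoint T := by
    rw [ContinuousLinearMap.isSelfAdjoint_iff_isSymmetric]
    intro u w
    have h : ⟪u + (a : ℂ) • T u, T w⟫_ℂ = ⟪T u, w + (a : ℂ) • T w⟫_ℂ :=
      hC.inner_eq ((hTmem _ w).2 rfl) ((hTmem _ u).2 rfl)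
    rw [inner_add_left, inner_add_right, inner_smul_left, inner_smul_right, Complex.conj_ofReal,
      add_left_inj] at h
    exact h.symm
  have hunit {s : ℝ} (hs : s ∈ Set.Icc 0 (b - a)) :
      IsUnit ((1 : H →L[ℂ] H) - (s : ℂ) • T) := by
    have hres := (notMem_spectrum_iff hC.isClosed).1
      (hno (a + s) ⟨by linarith [hs.1], by linarith [hs.2]⟩)
    rw [ContinuousLinearMap.isUnit_iff_bijective]
    constructor
    · rw [injective_iff_map_eq_zero]
      intro u hu
      have hu' : u = (s : ℂ) • T u := sub_eq_zero.1 hu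
      have h1 : (T u, 0 + ((a + s : ℝ) : ℂ) • T u) ∈ C := by
        have := (hTmem _ u).2 rfl
        nth_rw 2 [hu'] at this
        rwa [← add_smul, add_comm, ← Complex.ofReal_add, ← zero_add (_ • _)] at this
      have h2 : T u = 0 := (hres 0).unique h1 (by simp [← Prod.zero_eq_mk])
      rw [hu', h2, smul_zero]
    · intro w
      obtain ⟨v, hv, -⟩ := hres w
      -- For v = (C - a - s)⁻¹w this identity makes w + s v a preimage of w under 1 - sT.
      have h1 : v = T (w + (s : ℂ) • v) := by
        rw [← hTmem]
        convert hv using 2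
        push_cast
        module
      refine ⟨w + (s : ℂ) • v, ?_⟩
      change w + (s : ℂ) • v - (s : ℂ) • T (w + (s : ℂ) • v) = w
      rw [← h1, add_sub_cancel_right]
  set S : H →L[ℂ] H := 1 - ((b - a : ℝ) : ℂ) • T with hS
  have hSpos : 0 ≤ S := by
    rw [hS, Complex.coe_smul]
    refine one_sub_smul_nonneg hTsymm (sub_nonneg.2 hab.le) fun s hs ↦ ?_
    rw [← Complex.coe_smul]
    exact hunit hs
  obtain ⟨ψ, hψ⟩ := (ContinuousLinearMap.isUnit_iff_bijective.1
    (hunit (s := b - a) ⟨by linarith, le_rfl⟩)).2 φ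
  have hψS : S ψ = φ := hψ
  have hψT : ψ = φ + ((b - a : ℝ) : ℂ) • T ψ := sub_eq_iff_eq_add.1 hψ
  have hψd : ψ ∈ G.defect b := by
    -- An element of `B` plus an element of `C`, both inside the adjoint of `G`.
    have e : (ψ, (b : ℂ) • ψ) =
        (φ, (a : ℂ) • φ) + ((b - a : ℝ) : ℂ) • (T ψ, ψ + (a : ℂ) • T ψ) := by
      ext
      · exact hψT
      · change (b : ℂ) • ψ = (a : ℂ) • φ + ((b - a : ℝ) : ℂ) • (ψ + (a : ℂ) • T ψ)
        have : φ = ψ - ((b - a : ℝ) : ℂ) • T ψ := hψ.symm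
        rw [this]
        push_cast
        module
    rw [mem_defect, e]
    exact Submodule.add_mem _ (hB.le_adjoint hGB hφ)
      (Submodule.smul_mem _ _ (hC.le_adjoint hGC ((hTmem _ _).2 rfl)))
  obtain ⟨c, hc⟩ := hG.eq_smul (mem_defect.2 (hB.le_adjoint hGB hχ)) hχ0 hψd
  have h0 : ⟪ψ, S ψ⟫_ℂ = 0 := by
    rw [hψS, ← hc, inner_smul_left, hB.inner_eigenvectors_eq_zero hχ hφ hχ0
      (by exact_mod_cast hab.ne'), mul_zero]
  -- With S = R*R, ⟨ψ, Sψ⟩ = ‖Rψ‖², so Rψ = 0 and φ = Sψ = 0.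
  obtain ⟨R, hR⟩ := CStarAlgebra.nonneg_iff_eq_star_mul_self.1 hSpos
  rw [hR, mul_apply_eq_comp, ContinuousLinearMap.star_eq_adjoint,
    ContinuousLinearMap.adjoint_inner_right, inner_self_eq_zero] at h0
  apply hφ0
  rw [← hψS, hR, mul_apply_eq_comp, h0, map_zero]

/-- Disjointness makes the point of `exists_mem_Icc` interior. It is unique, since two points of `C`
would enclose one of `B`, contradicting consecutiveness. -/
theorem IsRegularDefectOne.separates [CompleteSpace H] (hG : G.IsRegularDefectOne)
    (hGB : G ≤ B) (hB : B.IsSelfAdjoint) (hGC : G ≤ C) (hC : C.IsSelfAdjoint)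
    (hdisj : Disjoint B.realSpectrum C.realSpectrum) :
    Separates C.realSpectrum B.realSpectrum := by
  have key {B C : LinRel H} (hGB : G ≤ B) (hB : B.IsSelfAdjoint) (hGC : G ≤ C)
      (hC : C.IsSelfAdjoint) (hdisj : Disjoint B.realSpectrum C.realSpectrum) {a b : ℝ}
      (ha : a ∈ B.realSpectrum) (hb : b ∈ B.realSpectrum) (hab : a < b) :
      ∃ t ∈ C.realSpectrum, a < t ∧ t < b := by
    obtain ⟨t, ht, htC⟩ := hG.exists_mem_Icc hGB hB hGC hC hab ha hb
    have hne {y : ℝ} (hy : y ∈ B.realSpectrum) : y ≠ t := fun e ↦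
      Set.disjoint_left.1 hdisj hy (e ▸ htC)
    exact ⟨t, htC, lt_of_le_of_ne ht.1 (hne ha), lt_of_le_of_ne ht.2 (hne hb).symm⟩
  intro a ha b hb hab hcons
  obtain ⟨t, ht, hat, htb⟩ := key hGB hB hGC hC hdisj ha hb hab
  have hnlt {s t : ℝ} (hs : s ∈ C.realSpectrum) (has : a < s) (ht : t ∈ C.realSpectrum)
      (htb : t < b) : ¬ s < t := fun hst ↦ by
    obtain ⟨c, hc, hsc, hct⟩ := key hGC hC hGB hB hdisj.symm hs ht hst
    exact hcons c hc ⟨has.trans hsc, hct.trans htb⟩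
  exact ⟨t, ⟨ht, hat, htb⟩, fun s ⟨hs, has, hsb⟩ ↦
    le_antisymm (not_lt.1 (hnlt ht hat hs hsb)) (not_lt.1 (hnlt hs has ht htb))⟩

end LinRel

/-! ### Application to the graph of the operator -/

theorem IsSymmetric.graph_le_adjoint {A : H →ₗ.[ℂ] H} (hA : IsSymmetric A) :
    A.graph ≤ Submodule.adjoint A.graph := by
  intro p hp
  rw [LinRel.mem_adjoint_iff_inner]
  intro q hq
  obtain ⟨x, hx1, hx2⟩ := (LinearPMap.mem_graph_iff A).1 hp
  obtain ⟨y, hy1, hy2⟩ := (LinearPMap.mem_graph_iff A).1 hq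
  rw [← hx1, ← hx2, ← hy1, ← hy2]
  exact hA y x

theorem ClassEOne.isRegularDefectOne [CompleteSpace H] {A : H →ₗ.[ℂ] H} (hA : ClassEOne A) :
    LinRel.IsRegularDefectOne A.graph := by
  have hreg (z : ℂ) : ∃ d : ℝ, 0 < d ∧ LinRel.BoundedBelow A.graph z d := by
    obtain ⟨d, hd, h⟩ := hA.regular z
    refine ⟨d, hd, fun p hp ↦ ?_⟩
    obtain ⟨x, hx1, hx2⟩ := (LinearPMap.mem_graph_iff A).1 hp
    rw [← hx1, ← hx2]
    exact h x
  exact ⟨hA.closed, hreg, fun z ↦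
    (LinRel.finrank_defect_eq hA.closed hreg z Complex.I).trans hA.deficiency.1⟩

end SymmetricOperator

theorem mainTheorem4 {H : Type*} [NormedAddCommGroup H] [InnerProductSpace ℂ H]
    [CompleteSpace H] [TopologicalSpace.SeparableSpace H]
    (A : H →ₗ.[ℂ] H) (hA : SymmetricOperator.ClassEOne A) :
    -- the spectrum of each selfadjoint extension is real and consists of isolated eigenvalues
    -- of multiplicity one
    (∀ B : SymmetricOperator.LinRel H, SymmetricOperator.IsSelfAdjointExtension A B →
      ∀ z ∈ B.spectrum, z.im = 0 ∧ (∃ ε > 0, B.spectrum ∩ Metric.ball z ε = {z}) ∧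
        Module.finrank ℂ (B.shift z).ker = 1) ∧
    -- each real number is in the spectrum of exactly one selfadjoint extension
    (∀ x : ℝ, ∃! B : SymmetricOperator.LinRel H,
      SymmetricOperator.IsSelfAdjointExtension A B ∧ (x : ℂ) ∈ B.spectrum) ∧
    -- the spectra of any two distinct selfadjoint extensions are interlaced
    (∀ B B' : SymmetricOperator.LinRel H, SymmetricOperator.IsSelfAdjointExtension A B →
      SymmetricOperator.IsSelfAdjointExtension A B' → B ≠ B' →
      SymmetricOperator.Interlaced B.realSpectrum B'.realSpectrum) := by
  have hG := hA.isRegularDefectOne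
  have hsymm := hA.symmetric.graph_le_adjoint
  refine ⟨fun B hB z hz ↦ ⟨hG.im_eq_zero hB.1 hB.2 hz, hG.isolated hB.1 hB.2 hz,
    hG.finrank_ker hB.1 hB.2 hz⟩,
    fun x ↦ hG.existsUnique_extension hsymm (Complex.conj_ofReal x), fun B B' hB hB' hne ↦ ?_⟩
  have hdisj : Disjoint B.realSpectrum B'.realSpectrum :=
    Set.disjoint_left.2 fun x hx hx' ↦
      hne (hG.eq_of_mem_spectrum hB.1 hB.2 hB'.1 hB'.2 hsymm hx hx')
  exact ⟨hdisj, hG.separates hB.1 hB.2 hB'.1 hB'.2 hdisj,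
    hG.separates hB'.1 hB'.2 hB.1 hB.2 hdisj.symm⟩
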